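/- **Setting.** Let $T$ be a set with a family $\mathcal I$ of non-empty subsets called intervals, a set $\mathcal T$ of admissible interval-point pairs $(I,t)$ ($I\in\mathcal I$, $t\in T$), and a collection $\mathcal A$ of subfamilies $\mathbf S\subseteq\mathcal T$. An elementary set is a non-empty finite union of mutually disjoint intervals. A division of $E$ from $\mathbf S$ is a finite set of pairs $(I,t)\in\mathbf S$ whose intervals are mutually disjoint with union $E$, one $t$ for each $I$; $\mathbf S$ divides $E$ if such a division exists. Put $E^*=\{t:(I,t)\in\mathcal T,\ I\subseteq E\}$. This is a *division space* if the following hold. - Every elementary set is divided by some $\mathbf S\in\mathcal A$. - If $\mathbf S_1,\mathbf S_2\in\mathcal A$ divide the elementary set $E$, some $\mathbf S_3\in\mathcal A$ with $\mathbf S_3\subseteq\mathbf S_1\cap\mathbf S_2$ divides $E$. - If $E_1,E_2$ are disjoint elementary sets and $\mathbf S\in\mathcal A$ divides $E_1\cup E_2$, some $\mathbf S'\in\mathcal A$ with $\mathbf S'\subseteq\{(I,t)\in\mathbf S: I\subseteq E_1\}$ divides $E_1$. - If $E_1,E_2$ are disjoint elementary sets and $\mathbf S_j\in\mathcal A$ divides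 $E_j$ with $I\subseteq E_j$ for all $(I,t)\in\mathbf S_j$ ($j=1,2$), some $\mathbf S\in\mathcal A$ with $\mathbf S\subseteq\mathbf S_1\cup\mathbf S_2$ divides $E_1\cup E_2$. It is *decomposable* if, moreover, for every elementary set $E$, every sequence $\mathbf S_j\in\mathcal A$ of families dividing $E$ and every sequence of mutually disjoint sets $X_j\subseteq T$, some $\mathbf S\in\mathcal A$ dividing $E$ satisfies $\{(I,t)\in\mathbf S:t\in X_j\}\subseteq\mathbf S_j$ for all $j$. A function $h(I,t)$ has integral $H=\int_E h$ if for every $\varepsilon>0$ some $\mathbf S\in\mathcal A$ divides $E$ such that $|\sum_{(I,t)\in\mathcal D}h(I,t)-H|<\varepsilon$ for all divisions $\mathcal D$ of $E$ from $\mathbf S$. The variation is $$V(h;\mathcal A;E;X)=\inf_{\mathbf S}\ \sup_{\mathcal D}\sum_{(I,t)\in\mathcal D,\,t\in X}|h(I,t)|,$$ over the $\mathbf S\in\mathcal A$ dividing $E$ and the divisions $\mathcal D$ of $E$ from $\mathbf S$. A *Fubini division space* consists of division spaces on $T^x$, $T^y$ and $T^z=T^x\times T^y$ such that the intervals of $T^z$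 are the products $I^x\times I^y$ of intervals, the admissible pairs of $T^z$ are the $(I^x\times I^y,(x,y))$ with $(I^x,x)$ and $(I^y,y)$ admissible, and the following holds, together with the same property with the roles of $x$ and $y$ interchanged. For all elementary sets $E^x,E^y$ and all $\mathbf S^z\in\mathcal A^z$ dividing $E^x\times E^y$ there are families $\mathbf S^y(x)\in\mathcal A^y$ dividing $E^y$ ($x\in E^{*x}$), such that for each choice of divisions $\mathcal D(x)$ of $E^y$ from $\mathbf S^y(x)$ ($x\in E^{*x}$) there is an $\mathbf S^x\in\mathcal A^x$ dividing $E^x$ with $(I^x\times I^y,(x,y))\in\mathbf S^z$ whenever $(I^x,x)\in\mathbf S^x$, $x\in E^{*x}$ and $(I^y,y)\in\mathcal D(x)$. **Theorem.** Let a Fubini division space be given with $T^x$ decomposable, let $E^x,E^y$ be elementary sets, $E^z=E^x\times E^y$, and let $h^x(I^x,x)$ and $h^y(x;I^y,y)$ ($x\in E^{*x}$) be real- or complex-valued. Suppose that $h^z(I^x\times I^y,(x,y))=h^x(I^x,x)\,h^y(x;I^y,y)$ has an integral $H$ in $E^z$. Let $X^x$ be the set of $x\in E^{*x}$ for which $J(x)=\int_{E^y}h^y(x;\cdot)$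 does not exist. Then $V(h^x;\mathcal A^x;E^x;X^x)=0$, and if we put $J(x)=0$ for $x\in X^x$, then $J(x)h^x(I^x,x)$ is integrable in $E^x$, with $$\int_{E^x}J\,dh^x=\int_{E^z}h^z=H.$$ -/

import Mathlib

open scoped ENNReal

/-- The data of a generalized Riemann integration process on a space `T`: the non-empty
generalized intervals, the admissible pairs `(I, t)` (`t` is an associated point of `I`; it need
not lie in `I`), and the collection of those families of admissible pairs that
control the limit process. -/
structure IntervalSystem (T : Type*) where
  /-- the generalized intervals -/
  intervals : Set (Set T)
  /-- the admissible interval-point pairs -/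
  pairs : Set (Set T × T)
  /-- the collection of families of interval-point pairs -/
  families : Set (Set (Set T × T))
  nonempty_of_mem : ∀ I ∈ intervals, I.Nonempty
  fst_mem_of_mem : ∀ p ∈ pairs, p.1 ∈ intervals
  subset_of_mem : ∀ S ∈ families, S ⊆ pairs

/-- `D` is a division of `E`, with one associated point chosen for each of its intervals, that
comes from the family `S`: finitely many pairs of `S` whose intervals are mutually disjoint and
have union `E`. -/
structure IsDivisionFrom {T : Type*} (S : Set (Set T × T)) (E : Set T)
    (D : Finset (Set T × T)) : Prop where
  subset : ∀ p ∈ D, p ∈ S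
  disjoint : ∀ p ∈ D, ∀ q ∈ D, p ≠ q → Disjoint p.1 q.1
  union : ⋃ p ∈ D, p.1 = E

/-- The family `S` divides `E`. -/
def Divides {T : Type*} (S : Set (Set T × T)) (E : Set T) : Prop :=
  ∃ D : Finset (Set T × T), IsDivisionFrom S E D

namespace IntervalSystem

variable {T : Type*}

/-- An elementary set: a non-empty finite union of mutually disjoint intervals. -/
def IsElementary (A : IntervalSystem T) (E : Set T) : Prop :=
  ∃ F : Finset (Set T), F.Nonempty ∧ (∀ I ∈ F, I ∈ A.intervals) ∧
    (∀ I ∈ F, ∀ J ∈ F, I ≠ J → Disjoint I J) ∧ ⋃ I ∈ F, I = E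

/-- The set `E*` of the associated points of the intervals contained in `E`. -/
def star (A : IntervalSystem T) (E : Set T) : Set T :=
  {x | ∃ I, (I, x) ∈ A.pairs ∧ I ⊆ E}

/-- A division space. -/
structure IsDivisionSpace (A : IntervalSystem T) : Prop where
  /-- the collection divides all elementary sets -/
  divides_all : ∀ E, A.IsElementary E → ∃ S ∈ A.families, Divides S E
  /-- the collection is directed in the sense of divisions -/
  directed : ∀ E, A.IsElementary E → ∀ S₁ ∈ A.families, ∀ S₂ ∈ A.families,
    Divides S₁ E → Divides S₂ E → ∃ S₃ ∈ A.families, Divides S₃ E ∧ S₃ ⊆ S₁ ∩ S₂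
  /-- the restriction property -/
  restriction : ∀ E₁ E₂, A.IsElementary E₁ → A.IsElementary E₂ → Disjoint E₁ E₂ →
    ∀ S ∈ A.families, Divides S (E₁ ∪ E₂) →
      ∃ S' ∈ A.families, S' ⊆ S ∧ (∀ p ∈ S', p.1 ⊆ E₁) ∧ Divides S' E₁
  /-- additivity -/
  additive : ∀ E₁ E₂, A.IsElementary E₁ → A.IsElementary E₂ → Disjoint E₁ E₂ →
    ∀ S₁ ∈ A.families, ∀ S₂ ∈ A.families, Divides S₁ E₁ → Divides S₂ E₂ →
      (∀ p ∈ S₁, p.1 ⊆ E₁) → (∀ p ∈ S₂, p.1 ⊆ E₂) →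
        ∃ S ∈ A.families, Divides S (E₁ ∪ E₂) ∧ S ⊆ S₁ ∪ S₂

/-- The collection has decomposable families. -/
def HasDecomposableFamilies (A : IntervalSystem T) : Prop :=
  ∀ E, A.IsElementary E → ∀ (S : ℕ → Set (Set T × T)) (X : ℕ → Set T),
    (∀ j, S j ∈ A.families ∧ Divides (S j) E) → (∀ i j, i ≠ j → Disjoint (X i) (X j)) →
      ∃ S' ∈ A.families, Divides S' E ∧ ∀ j, ∀ p ∈ S', p.2 ∈ X j → p ∈ S j

/-- A decomposable division space. -/
structure IsDecomposableDivisionSpace (A : IntervalSystem T) : Prop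
    extends A.IsDivisionSpace where
  decomposable : A.HasDecomposableFamilies

section Integral

variable {𝕜 : Type*} [RCLike 𝕜]

/-- `h` has the generalized Riemann integral `H` in `E`, relative to the families of `A`. -/
def HasIntegral (A : IntervalSystem T) (h : Set T → T → 𝕜) (E : Set T) (H : 𝕜) : Prop :=
  ∀ ε : ℝ, 0 < ε → ∃ S ∈ A.families, Divides S E ∧
    ∀ D, IsDivisionFrom S E D → ‖(∑ p ∈ D, h p.1 p.2) - H‖ < ε

/-- The variation `V(h; 𝒜; E; X)` of `h` in `X` relative to `E`: the infimum, over the families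
`S` that divide `E`, of the supremum of the sums of `|h(I, x)|`, restricted to `x ∈ X`, over the
divisions of `E` from `S`. -/
noncomputable def variation (A : IntervalSystem T) (h : Set T → T → 𝕜) (E X : Set T) : ℝ≥0∞ :=
  ⨅ S ∈ {S | S ∈ A.families ∧ Divides S E},
    ⨆ D ∈ {D | IsDivisionFrom S E D},
      ∑ p ∈ D, X.indicator (fun x => ENNReal.ofReal ‖h p.1 x‖) p.2

end Integral

end IntervalSystem

/-- The intervals of the product space are the products of intervals, and its interval-point pairs
are the products of interval-point pairs. -/
structure IsProductSystem {X Y : Type*} (Ax : IntervalSystem X) (Ay : IntervalSystem Y)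
    (Az : IntervalSystem (X × Y)) : Prop where
  intervals_eq : Az.intervals = {I | ∃ Ix ∈ Ax.intervals, ∃ Iy ∈ Ay.intervals, I = Ix ×ˢ Iy}
  pairs_eq : Az.pairs = {p | ∃ Ix x Iy y, (Ix, x) ∈ Ax.pairs ∧ (Iy, y) ∈ Ay.pairs ∧
    p = (Ix ×ˢ Iy, (x, y))}

/-- The Fubini property, in both orders of the variables. -/
structure HasFubiniProperty {X Y : Type*} (Ax : IntervalSystem X) (Ay : IntervalSystem Y)
    (Az : IntervalSystem (X × Y)) : Prop where
  first : ∀ Ex Ey, Ax.IsElementary Ex → Ay.IsElementary Ey →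
    ∀ Sz ∈ Az.families, Divides Sz (Ex ×ˢ Ey) →
      ∃ Sy : X → Set (Set Y × Y),
        (∀ x ∈ Ax.star Ex, Sy x ∈ Ay.families ∧ Divides (Sy x) Ey) ∧
        ∀ D : X → Finset (Set Y × Y), (∀ x ∈ Ax.star Ex, IsDivisionFrom (Sy x) Ey (D x)) →
          ∃ Sx ∈ Ax.families, Divides Sx Ex ∧
            ∀ Ix x, (Ix, x) ∈ Sx → x ∈ Ax.star Ex → ∀ Iy y, (Iy, y) ∈ D x →
              (Ix ×ˢ Iy, (x, y)) ∈ Sz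
  second : ∀ Ex Ey, Ax.IsElementary Ex → Ay.IsElementary Ey →
    ∀ Sz ∈ Az.families, Divides Sz (Ex ×ˢ Ey) →
      ∃ Sx : Y → Set (Set X × X),
        (∀ y ∈ Ay.star Ey, Sx y ∈ Ax.families ∧ Divides (Sx y) Ex) ∧
        ∀ D : Y → Finset (Set X × X), (∀ y ∈ Ay.star Ey, IsDivisionFrom (Sx y) Ex (D y)) →
          ∃ Sy ∈ Ay.families, Divides Sy Ey ∧
            ∀ Iy y, (Iy, y) ∈ Sy → y ∈ Ay.star Ey → ∀ Ix x, (Ix, x) ∈ D y →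
              (Ix ×ˢ Iy, (x, y)) ∈ Sz

/-- A Fubini division space: a division space on the product of two division spaces, the
three having the Fubini property in common. -/
structure IsFubiniDivisionSpace {X Y : Type*} (Ax : IntervalSystem X) (Ay : IntervalSystem Y)
    (Az : IntervalSystem (X × Y)) : Prop where
  x_space : Ax.IsDivisionSpace
  y_space : Ay.IsDivisionSpace
  z_space : Az.IsDivisionSpace
  product : IsProductSystem Ax Ay Az
  fubini : HasFubiniProperty Ax Ay Az

/-! Fix a family on the product whose sums lie within `ε` of `H`. For two choices `D₁(x)`, `D₂(x)`
of divisions of `Ey`, one outer family serves both, and over any outer division each pair may use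
either choice. Comparing such mixtures bounds every partial sum of `hx * (s₁ - s₂)`, where `sᵢ` is
the inner sum over `Dᵢ`, so the sum of the norms is at most `8 * ε` (`exists_inner_families`). Two
uses follow. Where the section is not integrable, the Cauchy criterion gives choices with `‖s₁ - s₂‖
≥ η x > 0`; hence `η * ‖hx‖` is null on `N`, and decomposability removes `η` (`IsNullIn.mul_left`).
Elsewhere `D₂` is taken so close to the integral that `‖s₁ - J‖ ≤ 2 * ‖s₁ - s₂‖`, so `J` may replace
`s₁` in the iterated sum, which is close to `H`. On `N` the replacement costs `‖s₁‖ * ‖hx‖`, again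
null by decomposability. -/

open Classical in
/-- The norms of finitely many scalars are controlled by the norms of their partial sums. -/
theorem sum_norm_le_four_mul_of_forall_subset {ι 𝕜 : Type*} [RCLike 𝕜] (s : Finset ι) (a : ι → 𝕜)
    (c : ℝ) (h : ∀ t ⊆ s, ‖∑ i ∈ t, a i‖ ≤ c) : ∑ i ∈ s, ‖a i‖ ≤ 4 * c := by
  -- For a real functional, the nonnegative and the negative terms are each a partial sum, costing
  -- `c` apiece; real and imaginary parts then give `4 * c`.
  have key : ∀ r : 𝕜 →+ ℝ, (∀ z, |r z| ≤ ‖z‖) → ∑ i ∈ s, |r (a i)| ≤ 2 * c := by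
    intro r hr
    have bound : ∀ t ⊆ s, |∑ i ∈ t, r (a i)| ≤ c := fun t ht => by
      rw [← map_sum]
      exact (hr _).trans (h t ht)
    rw [← Finset.sum_filter_add_sum_filter_not s (fun i => 0 ≤ r (a i))]
    have h1 := (le_abs_self _).trans (bound _ (Finset.filter_subset (fun i => 0 ≤ r (a i)) s))
    have h2 := (neg_le_abs _).trans (bound _ (Finset.filter_subset (fun i => ¬ 0 ≤ r (a i)) s))
    rw [← Finset.sum_neg_distrib] at h2
    have e1 : ∑ i ∈ s with 0 ≤ r (a i), |r (a i)| = ∑ i ∈ s with 0 ≤ r (a i), r (a i) :=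
      Finset.sum_congr rfl fun i hi => abs_of_nonneg (Finset.mem_filter.1 hi).2
    have e2 : ∑ i ∈ s with ¬ 0 ≤ r (a i), |r (a i)| = ∑ i ∈ s with ¬ 0 ≤ r (a i), -r (a i) :=
      Finset.sum_congr rfl fun i hi => abs_of_neg (not_le.1 (Finset.mem_filter.1 hi).2)
    linarith
  have hre := key (RCLike.re : 𝕜 →+ ℝ) RCLike.abs_re_le_norm
  have him := key (RCLike.im : 𝕜 →+ ℝ) RCLike.abs_im_le_norm
  have hnorm : ∀ z : 𝕜, ‖z‖ ≤ |RCLike.re z| + |RCLike.im z| := fun z => by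
    refine abs_le_of_sq_le_sq' ?_ (by positivity) |>.2
    rw [RCLike.norm_sq_eq_def, add_sq, sq_abs, sq_abs]
    nlinarith [mul_nonneg (abs_nonneg (RCLike.re z)) (abs_nonneg (RCLike.im z))]
  have := Finset.sum_le_sum fun i (_ : i ∈ s) => hnorm (a i)
  rw [Finset.sum_add_distrib] at this
  linarith

/-! ### Divisions and their completion -/

theorem IsDivisionFrom.mono {T : Type*} {S S' : Set (Set T × T)} {E : Set T}
    {D : Finset (Set T × T)} (h : IsDivisionFrom S E D) (hS : S ⊆ S') : IsDivisionFrom S' E D :=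
  ⟨fun p hp => hS (h.subset p hp), h.disjoint, h.union⟩

theorem IsDivisionFrom.fst_subset {T : Type*} {S : Set (Set T × T)} {E : Set T}
    {D : Finset (Set T × T)} (h : IsDivisionFrom S E D) {p : Set T × T} (hp : p ∈ D) :
    p.1 ⊆ E := by
  rw [← h.union]
  exact Set.subset_biUnion_of_mem (u := fun q : Set T × T => q.1) hp

namespace IntervalSystem

variable {T : Type*} {A : IntervalSystem T} {E : Set T}

open Classical in
theorem isElementary_biUnion_fst {P : Finset (Set T × T)} (hne : P.Nonempty)
    (hint : ∀ p ∈ P, p.1 ∈ A.intervals)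
    (hdisj : ∀ p ∈ P, ∀ q ∈ P, p ≠ q → Disjoint p.1 q.1) :
    A.IsElementary (⋃ p ∈ P, p.1) := by
  refine ⟨P.image Prod.fst, hne.image _, ?_, ?_, ?_⟩
  · simp only [Finset.forall_mem_image]
    exact hint
  · simp only [Finset.forall_mem_image]
    intro p hp q hq hpq
    exact hdisj p hp q hq fun e => hpq (congrArg Prod.fst e)
  · exact Finset.set_biUnion_finset_image

theorem mem_star_of_mem_division {S : Set (Set T × T)} (hS : S ∈ A.families)
    {D : Finset (Set T × T)} (hD : IsDivisionFrom S E D) {p : Set T × T} (hp : p ∈ D) :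
    p.2 ∈ A.star E :=
  ⟨p.1, A.subset_of_mem S hS (hD.subset p hp), hD.fst_subset hp⟩

open Classical in
/-- A part of a division, coming from a family that divides the whole set, can be completed to a
division from that family. -/
theorem IsDivisionSpace.exists_division_of_subset (hA : A.IsDivisionSpace)
    {S S₀ : Set (Set T × T)} (hS : S ∈ A.families) (hSE : Divides S E) (hS₀ : S₀ ∈ A.families)
    {D P : Finset (Set T × T)} (hD : IsDivisionFrom S₀ E D) (hPD : P ⊆ D) (hPS : ∀ p ∈ P, p ∈ S) :
    ∃ D', IsDivisionFrom S E D' ∧ P ⊆ D' := by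
  have hint : ∀ p ∈ D, p.1 ∈ A.intervals := fun p hp =>
    A.fst_mem_of_mem p (A.subset_of_mem S₀ hS₀ (hD.subset p hp))
  rcases P.eq_empty_or_nonempty with rfl | hP
  · obtain ⟨D', hD'⟩ := hSE
    exact ⟨D', hD', Finset.empty_subset _⟩
  -- The restriction property applies to elementary sets only, and these are non-empty, so `P = ∅`
  -- and `P = D` are treated apart.
  rcases (D \ P).eq_empty_or_nonempty with hQ | hQ
  · have : D = P := (Finset.sdiff_eq_empty_iff_subset.1 hQ).antisymm hPD
    subst this
    exact ⟨D, ⟨hPS, hD.disjoint, hD.union⟩, subset_rfl⟩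
  have hunion : (⋃ p ∈ D \ P, p.1) ∪ (⋃ p ∈ P, p.1) = E := by
    rw [← Finset.set_biUnion_union, Finset.sdiff_union_of_subset hPD, hD.union]
  have hdisj : Disjoint (⋃ p ∈ D \ P, p.1) (⋃ p ∈ P, p.1) := by
    simp only [Set.disjoint_iUnion_left, Set.disjoint_iUnion_right]
    exact fun p hp q hq => hD.disjoint q (Finset.sdiff_subset hq) p (hPD hp) fun e =>
      (Finset.mem_sdiff.1 hq).2 (e ▸ hp)
  have hE1 : A.IsElementary (⋃ p ∈ D \ P, p.1) :=
    isElementary_biUnion_fst hQ (fun p hp => hint p (Finset.sdiff_subset hp))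
      fun p hp q hq => hD.disjoint p (Finset.sdiff_subset hp) q (Finset.sdiff_subset hq)
  have hE2 : A.IsElementary (⋃ p ∈ P, p.1) :=
    isElementary_biUnion_fst hP (fun p hp => hint p (hPD hp))
      fun p hp q hq => hD.disjoint p (hPD hp) q (hPD hq)
  obtain ⟨S', -, hS'S, -, D'', hD''⟩ :=
    hA.restriction _ _ hE1 hE2 hdisj S hS (by rwa [hunion])
  refine ⟨D'' ∪ P, ⟨?_, ?_, ?_⟩, Finset.subset_union_right⟩
  · intro p hp
    rcases Finset.mem_union.1 hp with hp | hp
    · exact hS'S (hD''.subset p hp)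
    · exact hPS p hp
  · have hcross : ∀ p ∈ D'', ∀ q ∈ P, Disjoint p.1 q.1 := fun p hp q hq =>
      hdisj.mono (hD''.fst_subset hp)
        (Set.subset_biUnion_of_mem (u := fun q : Set T × T => q.1) hq)
    intro p hp q hq hpq
    rcases Finset.mem_union.1 hp with hp | hp <;> rcases Finset.mem_union.1 hq with hq | hq
    · exact hD''.disjoint p hp q hq hpq
    · exact hcross p hp q hq
    · exact (hcross q hq p hp).symm
    · exact hD.disjoint p (hPD hp) q (hPD hq) hpq
  · rw [Finset.set_biUnion_union, hD''.union, hunion]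

/-! ### Null integrands and decomposability -/

/-- The sums of `f` over the divisions of `E` from a suitable family are arbitrarily small. -/
def IsNullIn (A : IntervalSystem T) (f : Set T → T → ℝ) (E : Set T) : Prop :=
  ∀ ε : ℝ, 0 < ε → ∃ S ∈ A.families, Divides S E ∧
    ∀ D, IsDivisionFrom S E D → ∑ p ∈ D, f p.1 p.2 ≤ ε

/-- In a decomposable division space, an integrand of variation zero keeps this property when it
is multiplied by a function of the associated point. -/
theorem IsNullIn.mul_left (hA : A.IsDecomposableDivisionSpace) (hE : A.IsElementary E)
    {f : Set T → T → ℝ} (hf : A.IsNullIn f E) (hf0 : ∀ I x, 0 ≤ f I x) (g : T → ℝ) :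
    A.IsNullIn (fun I x => g x * f I x) E := by
  classical
  intro ε hε
  -- On the slice `⌊g⌋₊ = j` the weight is at most `j + 1`; negative values of `g` fall harmlessly
  -- into `j = 0`. The slice bounds `ε / 2 / 2 ^ j` sum to `ε`.
  have hpos : ∀ j : ℕ, 0 < ε / 2 / 2 ^ j / ((j : ℝ) + 1) := fun j => by positivity
  choose S hS hSE hSsum using fun j => hf _ (hpos j)
  obtain ⟨S', hS', hS'E, hdec⟩ := hA.decomposable E hE S (fun j => {x | ⌊g x⌋₊ = j})
    (fun j => ⟨hS j, hSE j⟩) fun i j hij => Set.disjoint_left.2 fun x hi hj => hij (hi.symm.trans hj)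
  refine ⟨S', hS', hS'E, fun D hD => ?_⟩
  have hpart : ∀ j : ℕ, ∑ p ∈ D with ⌊g p.2⌋₊ = j, g p.2 * f p.1 p.2 ≤ ε / 2 / 2 ^ j := by
    intro j
    -- `S j` controls sums over full divisions only, so the slice is completed to one; since `f ≥
    -- 0`, the added terms only increase the sum.
    obtain ⟨D', hD', hsub⟩ := hA.exists_division_of_subset (hS j) (hSE j) hS' hD
      (Finset.filter_subset (fun p => ⌊g p.2⌋₊ = j) D) fun p hp => by
        rw [Finset.mem_filter] at hp
        exact hdec j p (hD.subset p hp.1) hp.2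
    calc ∑ p ∈ D with ⌊g p.2⌋₊ = j, g p.2 * f p.1 p.2
        ≤ ∑ p ∈ D with ⌊g p.2⌋₊ = j, ((j : ℝ) + 1) * f p.1 p.2 := by
          refine Finset.sum_le_sum fun p hp => mul_le_mul_of_nonneg_right ?_ (hf0 _ _)
          rw [← (Finset.mem_filter.1 hp).2]
          exact (Nat.lt_floor_add_one _).le
      _ = ((j : ℝ) + 1) * ∑ p ∈ D with ⌊g p.2⌋₊ = j, f p.1 p.2 := by rw [Finset.mul_sum]
      _ ≤ ((j : ℝ) + 1) * (ε / 2 / 2 ^ j / ((j : ℝ) + 1)) := by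
          refine mul_le_mul_of_nonneg_left ?_ (by positivity)
          exact (Finset.sum_le_sum_of_subset_of_nonneg hsub fun _ _ _ => hf0 _ _).trans
            (hSsum j D' hD')
      _ = ε / 2 / 2 ^ j := by field_simp
  calc ∑ p ∈ D, g p.2 * f p.1 p.2
      = ∑ j ∈ D.image fun p => ⌊g p.2⌋₊, ∑ p ∈ D with ⌊g p.2⌋₊ = j, g p.2 * f p.1 p.2 :=
        (Finset.sum_fiberwise_of_maps_to (fun p hp => Finset.mem_image_of_mem _ hp) _).symm
    _ ≤ ∑ j ∈ D.image fun p => ⌊g p.2⌋₊, ε / 2 / 2 ^ j := Finset.sum_le_sum fun j _ => hpart j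
    _ ≤ ∑' j : ℕ, ε / 2 / 2 ^ j :=
        (summable_geometric_two' ε).sum_le_tsum _ fun j _ => by positivity
    _ = ε := tsum_geometric_two' ε

/-! ### Variation and the Cauchy criterion -/

section Integral

variable {𝕜 : Type*} [RCLike 𝕜]

theorem variation_eq_zero_of_isNullIn {h : Set T → T → 𝕜} {N : Set T}
    (hN : A.IsNullIn (fun I x => N.indicator (fun x => ‖h I x‖) x) E) :
    A.variation h E N = 0 := by
  refine le_antisymm (ENNReal.le_of_forall_pos_le_add fun ε hε _ => ?_) zero_le
  obtain ⟨S, hS, hSE, hsum⟩ := hN ε (by exact_mod_cast hε)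
  rw [zero_add]
  refine iInf₂_le_of_le S ⟨hS, hSE⟩ (iSup₂_le fun D hD => ?_)
  have hterm : ∀ p : Set T × T, N.indicator (fun x => ENNReal.ofReal ‖h p.1 x‖) p.2 =
      ENNReal.ofReal (N.indicator (fun x => ‖h p.1 x‖) p.2) := fun p => by
    by_cases hp : p.2 ∈ N <;> simp [hp]
  rw [Finset.sum_congr rfl fun p _ => hterm p,
    ← ENNReal.ofReal_sum_of_nonneg fun p _ => Set.indicator_nonneg (fun _ _ => norm_nonneg _) _,
    ← ENNReal.ofReal_coe_nnreal]
  exact ENNReal.ofReal_le_ofReal (hsum D hD)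

/-- The Cauchy criterion for the generalized Riemann integral. -/
theorem IsDivisionSpace.exists_hasIntegral_of_cauchy (hA : A.IsDivisionSpace)
    (hE : A.IsElementary E) {h : Set T → T → 𝕜}
    (hc : ∀ η : ℝ, 0 < η → ∃ S ∈ A.families, Divides S E ∧ ∀ D₁ D₂, IsDivisionFrom S E D₁ →
      IsDivisionFrom S E D₂ → ‖(∑ p ∈ D₁, h p.1 p.2) - ∑ p ∈ D₂, h p.1 p.2‖ < η) :
    ∃ a, A.HasIntegral h E a := by
  choose S hS hSE hosc using fun n : ℕ => hc (1 / ((n : ℝ) + 1)) Nat.one_div_pos_of_nat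
  choose D hD using hSE
  have hlim : Filter.Tendsto (fun n : ℕ => 1 / ((n : ℝ) + 1)) Filter.atTop (nhds 0) :=
    tendsto_one_div_add_atTop_nhds_zero_nat
  have hcauchy : CauchySeq fun n => ∑ p ∈ D n, h p.1 p.2 := by
    refine cauchySeq_of_le_tendsto_0 (fun n : ℕ => 1 / ((n : ℝ) + 1) + 1 / ((n : ℝ) + 1)) ?_
      (by simpa using hlim.add hlim)
    intro n m k hn hm
    -- The families are not nested, so `D n` and `D m` are compared through a division from both `S
    -- n` and `S m`.
    obtain ⟨S₃, -, ⟨D₃, hD₃⟩, hsub⟩ :=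
      hA.directed E hE _ (hS n) _ (hS m) ⟨_, hD n⟩ ⟨_, hD m⟩
    have h1 := hosc n _ _ (hD n) (hD₃.mono (hsub.trans Set.inter_subset_left))
    have h2 := hosc m _ _ (hD m) (hD₃.mono (hsub.trans Set.inter_subset_right))
    rw [← dist_eq_norm] at h1 h2
    exact (dist_triangle_right _ _ _).trans (add_le_add
      (h1.le.trans (Nat.one_div_le_one_div hn)) (h2.le.trans (Nat.one_div_le_one_div hm)))
  obtain ⟨a, ha⟩ := cauchySeq_tendsto_of_complete hcauchy
  refine ⟨a, fun ε hε => ?_⟩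
  obtain ⟨n, hn1, hn2⟩ := ((hlim.eventually (gt_mem_nhds (half_pos hε))).and
    (Metric.tendsto_nhds.1 ha _ (half_pos hε))).exists
  refine ⟨S n, hS n, ⟨_, hD n⟩, fun D' hD' => ?_⟩
  have h1 := hosc n _ _ hD' (hD n)
  rw [← dist_eq_norm] at h1 ⊢
  linarith [dist_triangle (∑ p ∈ D', h p.1 p.2) (∑ p ∈ D n, h p.1 p.2) a]

end Integral

end IntervalSystem

/-! ### Product divisions and iterated sums -/

section Fubini

variable {𝕜 : Type*} [RCLike 𝕜] {X Y : Type*}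

open Classical in
/-- The product of a division of `Ex` with divisions of `Ey`, one for each pair of the former. -/
noncomputable def productDivision (D : Finset (Set X × X))
    (c : Set X × X → Finset (Set Y × Y)) : Finset (Set (X × Y) × (X × Y)) :=
  (D.sigma c).image fun r => (r.1.1 ×ˢ r.2.1, (r.1.2, r.2.2))

/-- The inner division depends on the pair, not just on its point, which leaves room for mixing two
choices. -/
theorem isDivisionFrom_productDivision {Sx : Set (Set X × X)} {Ex : Set X} {Ey : Set Y}
    {Sz : Set (Set (X × Y) × (X × Y))} {Sy : Set X × X → Set (Set Y × Y)}
    {D : Finset (Set X × X)} {c : Set X × X → Finset (Set Y × Y)}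
    (hD : IsDivisionFrom Sx Ex D) (hc : ∀ p ∈ D, IsDivisionFrom (Sy p) Ey (c p))
    (hSz : ∀ p ∈ D, ∀ q ∈ c p, (p.1 ×ˢ q.1, (p.2, q.2)) ∈ Sz) :
    IsDivisionFrom Sz (Ex ×ˢ Ey) (productDivision D c) := by
  classical
  refine ⟨?_, ?_, ?_⟩
  · simp only [productDivision, Finset.forall_mem_image, Finset.mem_sigma]
    exact fun r hr => hSz _ hr.1 _ hr.2
  · simp only [productDivision, Finset.forall_mem_image, Finset.mem_sigma]
    rintro ⟨p, q⟩ ⟨hp, hq⟩ ⟨p', q'⟩ ⟨hp', hq'⟩ hne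
    dsimp only at *
    rw [Set.disjoint_prod]
    by_cases hpp : p = p'
    · subst hpp
      exact Or.inr ((hc p hp).disjoint q hq q' hq' fun e => hne (by rw [e]))
    · exact Or.inl (hD.disjoint p hp p' hp' hpp)
  · ext ⟨x, y⟩
    rw [← hD.union]
    simp only [productDivision, Finset.set_biUnion_finset_image, Set.mem_iUnion, Finset.mem_sigma,
      Set.mem_prod, exists_prop]
    constructor
    · rintro ⟨⟨p, q⟩, ⟨hp, hq⟩, hx, hy⟩
      exact ⟨⟨p, hp, hx⟩, (hc p hp).fst_subset hq hy⟩
    · rintro ⟨⟨p, hp, hx⟩, hy⟩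
      rw [← (hc p hp).union] at hy
      simp only [Set.mem_iUnion, exists_prop] at hy
      obtain ⟨q, hq, hy⟩ := hy
      exact ⟨⟨p, q⟩, ⟨hp, hq⟩, hx, hy⟩

/-- No product pair arises twice: a non-empty product determines its factors, and distinct pairs of
a division have disjoint, hence different, non-empty intervals. -/
theorem sum_productDivision {Sx : Set (Set X × X)} {Ex : Set X} {Ey : Set Y}
    {Sy : Set X × X → Set (Set Y × Y)}
    {D : Finset (Set X × X)} {c : Set X × X → Finset (Set Y × Y)}
    (hD : IsDivisionFrom Sx Ex D) (hc : ∀ p ∈ D, IsDivisionFrom (Sy p) Ey (c p))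
    (hnx : ∀ p ∈ D, p.1.Nonempty) (hny : ∀ p ∈ D, ∀ q ∈ c p, q.1.Nonempty)
    {M : Type*} [AddCommMonoid M] (h : Set (X × Y) → X × Y → M) :
    ∑ r ∈ productDivision D c, h r.1 r.2 =
      ∑ p ∈ D, ∑ q ∈ c p, h (p.1 ×ˢ q.1) (p.2, q.2) := by
  classical
  rw [productDivision, Finset.sum_image, Finset.sum_sigma]
  rintro ⟨p, q⟩ hr ⟨p', q'⟩ hr' e
  simp only [Finset.coe_sigma, Set.mem_sigma_iff, Finset.mem_coe] at hr hr'
  obtain ⟨hp, hq⟩ := hr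
  obtain ⟨hp', hq'⟩ := hr'
  have hset : p.1 ×ˢ q.1 = p'.1 ×ˢ q'.1 := congrArg Prod.fst e
  obtain ⟨h1, h2⟩ := (Set.prod_eq_prod_iff_of_nonempty ((hnx p hp).prod (hny p hp q hq))).1 hset
  have hpp : p = p' := by
    by_contra hne
    have := hD.disjoint p hp p' hp' hne
    rw [← h1, disjoint_self] at this
    exact (hnx p hp).ne_empty this
  subst hpp
  have hqq : q = q' := by
    by_contra hne
    have := (hc p hp).disjoint q hq q' hq' hne
    rw [← h2, disjoint_self] at this
    exact (hny p hp q hq).ne_empty this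
  rw [hqq]

variable {Ax : IntervalSystem X} {Ay : IntervalSystem Y} {Az : IntervalSystem (X × Y)}

/-- The inner sums over two choices of divisions of `Ey` differ little in the mean, and the
iterated sums are close to the integral over the product. -/
theorem IsFubiniDivisionSpace.exists_inner_families (hF : IsFubiniDivisionSpace Ax Ay Az)
    {Ex : Set X} {Ey : Set Y} (hEx : Ax.IsElementary Ex) (hEy : Ay.IsElementary Ey)
    {hx : Set X → X → 𝕜} {hy : X → Set Y → Y → 𝕜} {hz : Set (X × Y) → X × Y → 𝕜}
    (hprod : ∀ Ix x Iy y, (Ix, x) ∈ Ax.pairs → x ∈ Ax.star Ex → (Iy, y) ∈ Ay.pairs →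
      hz (Ix ×ˢ Iy) (x, y) = hx Ix x * hy x Iy y)
    {H : 𝕜} (hH : Az.HasIntegral hz (Ex ×ˢ Ey) H) {ε : ℝ} (hε : 0 < ε) :
    ∃ Sy : X → Set (Set Y × Y), (∀ x ∈ Ax.star Ex, Sy x ∈ Ay.families ∧ Divides (Sy x) Ey) ∧
      ∀ D₁ D₂ : X → Finset (Set Y × Y), (∀ x ∈ Ax.star Ex, IsDivisionFrom (Sy x) Ey (D₁ x)) →
        (∀ x ∈ Ax.star Ex, IsDivisionFrom (Sy x) Ey (D₂ x)) →
        ∃ Sx ∈ Ax.families, Divides Sx Ex ∧ ∀ D, IsDivisionFrom Sx Ex D →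
          ‖(∑ p ∈ D, hx p.1 p.2 * ∑ q ∈ D₁ p.2, hy p.2 q.1 q.2) - H‖ < ε ∧
          ∑ p ∈ D, ‖(∑ q ∈ D₁ p.2, hy p.2 q.1 q.2) - ∑ q ∈ D₂ p.2, hy p.2 q.1 q.2‖ *
            ‖hx p.1 p.2‖ ≤ 8 * ε := by
  classical
  obtain ⟨Sz, hSz, hSzE, hsum⟩ := hH ε hε
  obtain ⟨Sy, hSy, hfub⟩ := hF.fubini.first Ex Ey hEx hEy Sz hSz hSzE
  refine ⟨Sy, hSy, fun D₁ D₂ hD₁ hD₂ => ?_⟩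
  obtain ⟨S₁, hS₁, hS₁E, hS₁z⟩ := hfub D₁ hD₁
  obtain ⟨S₂, hS₂, hS₂E, hS₂z⟩ := hfub D₂ hD₂
  obtain ⟨Sx, hSx, hSxE, hsub⟩ := hF.x_space.directed Ex hEx _ hS₁ _ hS₂ hS₁E hS₂E
  refine ⟨Sx, hSx, hSxE, fun D hD => ?_⟩
  have hstar : ∀ p ∈ D, p.2 ∈ Ax.star Ex := fun p hp =>
    IntervalSystem.mem_star_of_mem_division hSx hD hp
  have hpairs : ∀ p ∈ D, p ∈ Ax.pairs := fun p hp => Ax.subset_of_mem _ hSx (hD.subset p hp)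
  have hmix : ∀ Q : Finset (Set X × X),
      ‖(∑ p ∈ D, hx p.1 p.2 * ∑ q ∈ (if p ∈ Q then D₁ p.2 else D₂ p.2), hy p.2 q.1 q.2) - H‖
        < ε := by
    intro Q
    have hc : ∀ p ∈ D, IsDivisionFrom (Sy p.2) Ey (if p ∈ Q then D₁ p.2 else D₂ p.2) := by
      intro p hp
      split_ifs
      · exact hD₁ _ (hstar p hp)
      · exact hD₂ _ (hstar p hp)
    have hcpairs : ∀ p ∈ D, ∀ q ∈ (if p ∈ Q then D₁ p.2 else D₂ p.2), q ∈ Ay.pairs :=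
      fun p hp q hq => Ay.subset_of_mem _ (hSy _ (hstar p hp)).1 ((hc p hp).subset q hq)
    have hcz : ∀ p ∈ D, ∀ q ∈ (if p ∈ Q then D₁ p.2 else D₂ p.2),
        (p.1 ×ˢ q.1, (p.2, q.2)) ∈ Sz := by
      intro p hp q hq
      have hpS := hsub (hD.subset p hp)
      split_ifs at hq
      · exact hS₁z _ _ hpS.1 (hstar p hp) _ _ hq
      · exact hS₂z _ _ hpS.2 (hstar p hp) _ _ hq
    have key := hsum _ (isDivisionFrom_productDivision hD hc hcz)
    rw [sum_productDivision hD hc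
      (fun p hp => Ax.nonempty_of_mem _ (Ax.fst_mem_of_mem _ (hpairs p hp)))
      (fun p hp q hq => Ay.nonempty_of_mem _ (Ay.fst_mem_of_mem _ (hcpairs p hp q hq)))] at key
    convert key using 4 with p hp
    rw [Finset.mul_sum]
    exact Finset.sum_congr rfl fun q hq =>
      (hprod _ _ _ _ (hpairs p hp) (hstar p hp) (hcpairs p hp q hq)).symm
  constructor
  · convert hmix D using 4 with p hp
    rw [if_pos hp]
  · have := sum_norm_le_four_mul_of_forall_subset D (fun p => hx p.1 p.2 *
      ((∑ q ∈ D₁ p.2, hy p.2 q.1 q.2) - ∑ q ∈ D₂ p.2, hy p.2 q.1 q.2)) (2 * ε) ?_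
    · simp only [norm_mul] at this
      calc _ = _ := Finset.sum_congr rfl fun p _ => mul_comm _ _
        _ ≤ _ := this
        _ = 8 * ε := by ring
    intro Q hQ
    -- The mixtures for `Q` and `∅` agree off `Q`, so their difference is the partial sum over `Q`.
    have e : ∑ p ∈ Q, hx p.1 p.2 *
        ((∑ q ∈ D₁ p.2, hy p.2 q.1 q.2) - ∑ q ∈ D₂ p.2, hy p.2 q.1 q.2) =
        ((∑ p ∈ D, hx p.1 p.2 * ∑ q ∈ (if p ∈ Q then D₁ p.2 else D₂ p.2), hy p.2 q.1 q.2) - H) -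
        ((∑ p ∈ D, hx p.1 p.2 *
          ∑ q ∈ (if p ∈ (∅ : Finset _) then D₁ p.2 else D₂ p.2), hy p.2 q.1 q.2) - H) := by
      rw [sub_sub_sub_cancel_right, ← Finset.sum_sub_distrib, ← Finset.sum_subset hQ]
      · refine Finset.sum_congr rfl fun p hp => ?_
        rw [if_pos hp, if_neg (Finset.notMem_empty p), mul_sub]
      · intro p _ hp
        rw [if_neg hp, if_neg (Finset.notMem_empty p), sub_self]
    rw [e]
    linarith [norm_sub_le
      ((∑ p ∈ D, hx p.1 p.2 * ∑ q ∈ (if p ∈ Q then D₁ p.2 else D₂ p.2), hy p.2 q.1 q.2) - H)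
      ((∑ p ∈ D, hx p.1 p.2 *
        ∑ q ∈ (if p ∈ (∅ : Finset _) then D₁ p.2 else D₂ p.2), hy p.2 q.1 q.2) - H),
      hmix Q, hmix ∅]

/-- The points whose sections are not integrable carry no variation of the outer integrand. -/
theorem IsFubiniDivisionSpace.isNullIn_indicator_not_integrable
    (hF : IsFubiniDivisionSpace Ax Ay Az) (hdec : Ax.IsDecomposableDivisionSpace)
    {Ex : Set X} {Ey : Set Y} (hEx : Ax.IsElementary Ex) (hEy : Ay.IsElementary Ey)
    {hx : Set X → X → 𝕜} {hy : X → Set Y → Y → 𝕜} {hz : Set (X × Y) → X × Y → 𝕜}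
    (hprod : ∀ Ix x Iy y, (Ix, x) ∈ Ax.pairs → x ∈ Ax.star Ex → (Iy, y) ∈ Ay.pairs →
      hz (Ix ×ˢ Iy) (x, y) = hx Ix x * hy x Iy y)
    {H : 𝕜} (hH : Az.HasIntegral hz (Ex ×ˢ Ey) H) {N : Set X} (hNE : N ⊆ Ax.star Ex)
    (hN : ∀ x ∈ N, ¬ ∃ a : 𝕜, Ay.HasIntegral (hy x) Ey a) :
    Ax.IsNullIn (fun I x => N.indicator (fun x => ‖hx I x‖) x) Ex := by
  classical
  have hosc : ∀ x, ∃ η : ℝ, 0 < η ∧ (x ∈ N → ∀ S ∈ Ay.families, Divides S Ey →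
      ∃ D₁ D₂, IsDivisionFrom S Ey D₁ ∧ IsDivisionFrom S Ey D₂ ∧
        η ≤ ‖(∑ q ∈ D₁, hy x q.1 q.2) - ∑ q ∈ D₂, hy x q.1 q.2‖) := by
    intro x
    by_cases hxN : x ∈ N
    · by_contra! hcon
      refine hN x hxN (hF.y_space.exists_hasIntegral_of_cauchy hEy fun η hη => ?_)
      obtain ⟨-, S, hS, hSE, h⟩ := hcon η hη
      exact ⟨S, hS, hSE, h⟩
    -- Any positive default serves off `N`, where the indicator vanishes.
    · exact ⟨1, one_pos, fun h => absurd h hxN⟩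
  choose η hη hηosc using hosc
  have hscaled : Ax.IsNullIn (fun I x => N.indicator (fun x => η x * ‖hx I x‖) x) Ex := by
    intro ε hε
    obtain ⟨Sy, hSy, hSyD⟩ :=
      hF.exists_inner_families hEx hEy hprod hH (ε := ε / 8) (by positivity)
    have hchoice : ∀ x, ∃ D₁ D₂ : Finset (Set Y × Y), x ∈ Ax.star Ex →
        IsDivisionFrom (Sy x) Ey D₁ ∧ IsDivisionFrom (Sy x) Ey D₂ ∧
        (x ∈ N → η x ≤ ‖(∑ q ∈ D₁, hy x q.1 q.2) - ∑ q ∈ D₂, hy x q.1 q.2‖) := by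
      intro x
      by_cases hxE : x ∈ Ax.star Ex
      · by_cases hxN : x ∈ N
        · obtain ⟨D₁, D₂, h1, h2, h3⟩ := hηosc x hxN _ (hSy x hxE).1 (hSy x hxE).2
          exact ⟨D₁, D₂, fun _ => ⟨h1, h2, fun _ => h3⟩⟩
        · obtain ⟨D, hD⟩ := (hSy x hxE).2
          exact ⟨D, D, fun _ => ⟨hD, hD, fun h => absurd h hxN⟩⟩
      · exact ⟨∅, ∅, fun h => absurd h hxE⟩
    choose D₁ D₂ hD using hchoice
    obtain ⟨Sx, hSx, hSxE, hsum⟩ :=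
      hSyD D₁ D₂ (fun x h => (hD x h).1) fun x h => (hD x h).2.1
    refine ⟨Sx, hSx, hSxE, fun D hDx => (Finset.sum_le_sum fun p _ => ?_).trans
      ((hsum D hDx).2.trans_eq (by ring))⟩
    beta_reduce
    by_cases hp : p.2 ∈ N
    · rw [Set.indicator_of_mem hp]
      exact mul_le_mul_of_nonneg_right ((hD _ (hNE hp)).2.2 hp) (norm_nonneg _)
    · rw [Set.indicator_of_notMem hp]
      positivity
  have := hscaled.mul_left hdec hEx
    (fun I x => Set.indicator_nonneg (fun y _ => mul_nonneg (hη y).le (norm_nonneg _)) x)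
    fun x => (η x)⁻¹
  convert this using 3 with I x
  by_cases hxN : x ∈ N
  · simp [hxN, (hη x).ne']
  · simp [hxN]

end Fubini

/-! ### The Fubini theorem -/

theorem theorem38 {𝕜 : Type*} [RCLike 𝕜] {X Y : Type*}
    (Ax : IntervalSystem X) (Ay : IntervalSystem Y) (Az : IntervalSystem (X × Y))
    (hF : IsFubiniDivisionSpace Ax Ay Az) (hdec : Ax.IsDecomposableDivisionSpace)
    (Ex : Set X) (Ey : Set Y) (hEx : Ax.IsElementary Ex) (hEy : Ay.IsElementary Ey)
    (hx : Set X → X → 𝕜) (hy : X → Set Y → Y → 𝕜) (hz : Set (X × Y) → X × Y → 𝕜)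
    (hprod : ∀ Ix x Iy y, (Ix, x) ∈ Ax.pairs → x ∈ Ax.star Ex → (Iy, y) ∈ Ay.pairs →
      hz (Ix ×ˢ Iy) (x, y) = hx Ix x * hy x Iy y)
    (H : 𝕜) (hH : Az.HasIntegral hz (Ex ×ˢ Ey) H)
    (N : Set X)
    (hN : N = {x | x ∈ Ax.star Ex ∧ ¬ ∃ a : 𝕜, Ay.HasIntegral (hy x) Ey a}) :
    Ax.variation hx Ex N = 0 ∧
      ∀ J : X → 𝕜, (∀ x ∈ Ax.star Ex \ N, Ay.HasIntegral (hy x) Ey (J x)) →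
        (∀ x ∈ N, J x = 0) →
          Ax.HasIntegral (fun I x => J x * hx I x) Ex H := by
  classical
  have hnull : Ax.IsNullIn (fun I x => N.indicator (fun x => ‖hx I x‖) x) Ex :=
    hF.isNullIn_indicator_not_integrable hdec hEx hEy hprod hH
      (fun x h => by rw [hN] at h; exact h.1) fun x h => by rw [hN] at h; exact h.2
  refine ⟨IntervalSystem.variation_eq_zero_of_isNullIn hnull, fun J hJ hJN ε hε => ?_⟩
  -- The total error is below `ε / 32 + 2 * 8 * ε / 32 + ε / 4 < ε`.
  obtain ⟨Sy, hSy, hSyD⟩ :=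
    hF.exists_inner_families hEx hEy hprod hH (ε := ε / 32) (by positivity)
  have hchoice : ∀ x, ∃ D₁ D₂ : Finset (Set Y × Y), x ∈ Ax.star Ex →
      IsDivisionFrom (Sy x) Ey D₁ ∧ IsDivisionFrom (Sy x) Ey D₂ ∧
      (x ∉ N → ‖(∑ q ∈ D₁, hy x q.1 q.2) - J x‖ ≤
        2 * ‖(∑ q ∈ D₁, hy x q.1 q.2) - ∑ q ∈ D₂, hy x q.1 q.2‖) := by
    intro x
    by_cases hxE : x ∈ Ax.star Ex
    swap
    · exact ⟨∅, ∅, fun h => absurd h hxE⟩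
    obtain ⟨D₁, hD₁⟩ := (hSy x hxE).2
    by_cases hxN : x ∈ N
    · exact ⟨D₁, D₁, fun _ => ⟨hD₁, hD₁, fun h => absurd hxN h⟩⟩
    -- Otherwise half of `‖s - J x‖` is a positive tolerance, and `D₂` is chosen to that accuracy.
    by_cases hs : (∑ q ∈ D₁, hy x q.1 q.2) = J x
    · exact ⟨D₁, D₁, fun _ => ⟨hD₁, hD₁, fun _ => by simp [hs]⟩⟩
    have hpos : 0 < ‖(∑ q ∈ D₁, hy x q.1 q.2) - J x‖ := norm_pos_iff.2 (sub_ne_zero.2 hs)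
    obtain ⟨S, hS, hSE, hSJ⟩ := hJ x ⟨hxE, hxN⟩ _ (half_pos hpos)
    obtain ⟨S', -, ⟨D₂, hD₂⟩, hsub⟩ :=
      hF.y_space.directed Ey hEy _ (hSy x hxE).1 _ hS (hSy x hxE).2 hSE
    refine ⟨D₁, D₂, fun _ => ⟨hD₁, hD₂.mono (hsub.trans Set.inter_subset_left), fun _ => ?_⟩⟩
    have h1 := hSJ D₂ (hD₂.mono (hsub.trans Set.inter_subset_right))
    have h2 := norm_sub_le_norm_sub_add_norm_sub (∑ q ∈ D₁, hy x q.1 q.2)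
      (∑ q ∈ D₂, hy x q.1 q.2) (J x)
    linarith
  choose D₁ D₂ hD using hchoice
  set s : X → 𝕜 := fun x => ∑ q ∈ D₁ x, hy x q.1 q.2
  obtain ⟨S₁, hS₁, hS₁E, hsum₁⟩ := hSyD D₁ D₂ (fun x h => (hD x h).1) fun x h => (hD x h).2.1
  -- With `D₁` fixed, `‖s x‖` depends on the point alone, as decomposability requires; no bound on
  -- it is needed.
  obtain ⟨S₂, hS₂, hS₂E, hsum₂⟩ := hnull.mul_left hdec hEx
    (fun I x => Set.indicator_nonneg (fun y _ => norm_nonneg _) x)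
    (fun x => ‖s x‖) (ε / 4) (by positivity)
  obtain ⟨S, hS, hSE, hsub⟩ := hF.x_space.directed Ex hEx _ hS₁ _ hS₂ hS₁E hS₂E
  refine ⟨S, hS, hSE, fun D hDx => ?_⟩
  obtain ⟨hclose, hmean⟩ := hsum₁ D (hDx.mono (hsub.trans Set.inter_subset_left))
  have hnullD := hsum₂ D (hDx.mono (hsub.trans Set.inter_subset_right))
  have hdiff : ‖(∑ p ∈ D, J p.2 * hx p.1 p.2) - ∑ p ∈ D, hx p.1 p.2 * s p.2‖ ≤
      2 * (8 * (ε / 32)) + ε / 4 := by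
    rw [← Finset.sum_sub_distrib]
    refine (norm_sum_le _ _).trans (le_trans (Finset.sum_le_sum fun p hp => ?_)
      ((Finset.sum_add_distrib.trans (congrArg (· + _) (Finset.mul_sum _ _ _).symm)).trans_le
        (add_le_add (mul_le_mul_of_nonneg_left hmean zero_le_two) hnullD)))
    have hpE := IntervalSystem.mem_star_of_mem_division hS hDx hp
    have e : J p.2 * hx p.1 p.2 - hx p.1 p.2 * s p.2 = -((s p.2 - J p.2) * hx p.1 p.2) := by ring
    rw [e, norm_neg, norm_mul]
    beta_reduce
    by_cases hpN : p.2 ∈ N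
    · rw [Set.indicator_of_mem hpN, hJN _ hpN, sub_zero]
      exact le_add_of_nonneg_left (by positivity)
    · rw [Set.indicator_of_notMem hpN, mul_zero, add_zero, ← mul_assoc]
      exact mul_le_mul_of_nonneg_right ((hD _ hpE).2.2 hpN) (norm_nonneg _)
  have := norm_sub_le_norm_sub_add_norm_sub (∑ p ∈ D, J p.2 * hx p.1 p.2)
    (∑ p ∈ D, hx p.1 p.2 * s p.2) H
  linarith
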